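/- Let $Z_1,Z_2,\dots$ be independent normal random variables with mean $\mu>0$ and variance $1$, let $S_m=\sum_{i=1}^m Z_i$ for $m\ge 1$, let $b>0$, and let \[\tau=\min\{m\ge 1:\ S_m<-b \text{ or } S_m>b\}.\] Let $\Phi$ be the standard normal distribution function and $R(a)=\dfrac{\Phi(a)}{1-\Phi(a)}$. Then $\tau<\infty$ almost surely, and \[ \frac{e^{2\mu b}-1}{e^{2\mu b}-R(-\mu)e^{-2\mu b}}\;<\;\mathbb P(S_\tau>b)\;<\;\frac{e^{2\mu b}R(\mu)-1}{e^{2\mu b}R(\mu)-e^{-2\mu b}}. \] -/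

import Mathlib

open MeasureTheory ProbabilityTheory

noncomputable section

/-- The standard normal distribution function `Φ`. -/
def stdNormalCDF (a : ℝ) : ℝ := cdf (gaussianReal 0 1) a

/-- The odds ratio `R(a) = Φ(a) / (1 - Φ(a))`. -/
def normalOdds (a : ℝ) : ℝ := stdNormalCDF a / (1 - stdNormalCDF a)

/-- The partial sums `S_m` of the first `m` terms of the sequence `Z 0, Z 1, …`
(so `Z i` plays the role of the `(i+1)`-st increment, and `S_0 = 0`). -/
def partialSum {Ω : Type*} (Z : ℕ → Ω → ℝ) (m : ℕ) (ω : Ω) : ℝ :=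
  ∑ i ∈ Finset.range m, Z i ω

/-- The exit time `τ = min {m ≥ 1 : S_m < -b or S_m > b}`, with value `⊤` if there is no such
`m`. -/
def exitTime {Ω : Type*} (Z : ℕ → Ω → ℝ) (b : ℝ) : Ω → WithTop ℕ :=
  hittingAfter (partialSum Z) {x : ℝ | x < -b ∨ b < x} 1

end

/-! The function `exp (-2 * μ * x)` is harmonic for the walk, so optional stopping makes its mean at
the exit equal to its value 1 at the start. Since the walk overshoots, only bounds on its mean over
each side are known. At the boundary itself, `exp (-2 * μ * b)` bounds it above on upward exits and
`exp (2 * μ * b)` bounds it below on downward exits. For the opposite bounds, the tilted mean over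
an overshoot is most extreme when the last jump starts on the boundary being crossed, which produces
the factors `R(-μ)` and `R(μ)`; this is `gaussianTail_mul_le`, an association inequality for two
decreasing exponentials. Freezing the function at such constants outside `[-b, b]` gives a strict
sub- or supersolution (`exp_lt_integral_twoSided`, `integral_twoSided_lt_exp`), and
`lt_of_lt_integral_twoSided` turns each into a linear inequality for the upward exit probability. -/

/-! ### Gaussian tails and exponential tilting. -/

/-- The mass that a normal law with mean `m` and unit variance gives to the positive half-line. -/
noncomputable def gaussianTail (m : ℝ) : ℝ := (gaussianReal m 1).real (Set.Ioi 0)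

/-- Completing the square: tilting a normal law by `exp (c * x)` shifts its mean by `c`. -/
lemma setIntegral_exp_gaussianReal (c m : ℝ) {S : Set ℝ} (hS : MeasurableSet S) :
    ∫ x in S, Real.exp (c * x) ∂gaussianReal m 1 =
      Real.exp (c * m + c ^ 2 / 2) * (gaussianReal (m + c) 1).real S := by
  rw [← integral_indicator hS, ← integral_indicator_one hS,
    integral_gaussianReal_eq_integral_smul one_ne_zero,
    integral_gaussianReal_eq_integral_smul one_ne_zero, ← integral_const_mul]
  refine integral_congr_ae (ae_of_all _ fun x ↦ ?_)
  by_cases hx : x ∈ S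
  · simp only [hx, Set.indicator_of_mem, smul_eq_mul, gaussianPDFReal, Pi.one_apply, mul_one,
      NNReal.coe_one]
    rw [mul_assoc, mul_left_comm (Real.exp _), ← Real.exp_add, ← Real.exp_add]
    congr 2
    ring
  · simp [hx]

lemma gaussianReal_real_Ioi (m b : ℝ) :
    (gaussianReal m 1).real (Set.Ioi b) = gaussianTail (m - b) := by
  rw [gaussianTail, ← gaussianReal_map_sub_const b,
    map_measureReal_apply (by fun_prop) measurableSet_Ioi]
  congr 1
  ext x
  simp

lemma gaussianReal_real_Iio (m b : ℝ) :
    (gaussianReal m 1).real (Set.Iio b) = gaussianTail (b - m) := by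
  rw [gaussianTail, ← gaussianReal_map_const_sub b,
    map_measureReal_apply (by fun_prop) measurableSet_Ioi]
  congr 1
  ext x
  simp

lemma gaussianReal_real_Iic (m b : ℝ) :
    (gaussianReal m 1).real (Set.Iic b) = gaussianTail (b - m) := by
  have := nullSingletonClass_gaussianReal (μ := m) (one_ne_zero : (1 : NNReal) ≠ 0)
  rw [← gaussianReal_real_Iio, measureReal_congr Iio_ae_eq_Iic]

lemma stdNormalCDF_eq_gaussianTail (a : ℝ) : stdNormalCDF a = gaussianTail a := by
  rw [stdNormalCDF, cdf_eq_real, gaussianReal_real_Iic, sub_zero]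

lemma one_sub_gaussianTail (a : ℝ) : 1 - gaussianTail a = gaussianTail (-a) := by
  have h := probReal_compl_eq_one_sub (μ := gaussianReal 0 1) (s := Set.Iic a) measurableSet_Iic
  rw [Set.compl_Iic, gaussianReal_real_Ioi, gaussianReal_real_Iic] at h
  simpa using h.symm

lemma normalOdds_eq (a : ℝ) : normalOdds a = gaussianTail a / gaussianTail (-a) := by
  rw [normalOdds, stdNormalCDF_eq_gaussianTail, one_sub_gaussianTail]

lemma gaussianReal_real_pos (m : ℝ) {S : Set ℝ} (hS : volume S ≠ 0) :
    0 < (gaussianReal m 1).real S := by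
  exact ENNReal.toReal_pos (fun h ↦ hS (gaussianReal_absolutelyContinuous' m one_ne_zero h))
    (measure_ne_top _ _)

lemma gaussianTail_pos (m : ℝ) : 0 < gaussianTail m :=
  gaussianReal_real_pos m (by simp)

lemma gaussianTail_le_one (m : ℝ) : gaussianTail m ≤ 1 := measureReal_le_one

lemma gaussianTail_mono : Monotone gaussianTail := by
  intro x y h
  have hx := gaussianReal_real_Iio 0 x
  have hy := gaussianReal_real_Iio 0 y
  rw [sub_zero] at hx hy
  rw [← hx, ← hy]
  exact measureReal_mono (Set.Iio_subset_Iio h)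

/-- The ratio of normal tails at `a + μ` and `a - μ`, tilted by `exp (2 * μ * a)`, is smallest at
`a = 0`: the overshoot is stochastically largest there. -/
lemma gaussianTail_mul_le {μ a : ℝ} (hμ : 0 < μ) (ha : 0 ≤ a) :
    gaussianTail (-μ) * gaussianTail (μ - a) ≤
      Real.exp (2 * μ * a) * gaussianTail (-μ - a) * gaussianTail μ := by
  set W := (gaussianReal μ 1).restrict (Set.Ioi 0) with hW
  have hint (c : ℝ) : Integrable (fun x ↦ Real.exp (c * x)) W :=
    (integrable_exp_mul_gaussianReal c).restrict
  have hval (c : ℝ) : ∫ x, Real.exp (c * x) ∂W =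
      Real.exp (c * μ + c ^ 2 / 2) * gaussianTail (μ + c) :=
    setIntegral_exp_gaussianReal c μ measurableSet_Ioi
  have hT := gaussianTail_pos μ
  have hT' := gaussianTail_pos (-μ)
  -- `ρ` is the mean of `exp (-2 * μ * x)` under normalized `W`, and `t₀` is the point where this
  -- function takes its mean value.
  set ρ := gaussianTail (-μ) / gaussianTail μ with hρ
  have hρ0 : 0 < ρ := div_pos hT' hT
  set t₀ := -Real.log ρ / (2 * μ) with ht₀
  have hρt : Real.exp (-2 * μ * t₀) = ρ := by
    rw [ht₀, show -2 * μ * (-Real.log ρ / (2 * μ)) = Real.log ρ by field_simp, Real.exp_log hρ0]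
  -- Chebyshev's association argument: both exponentials decrease, so their deviations from their
  -- values at `t₀` have the same sign. Integrating against `W` leaves no `t₀` term, by the choice
  -- of `ρ`.
  have hpt (x : ℝ) : Real.exp (-a * t₀) * Real.exp (-2 * μ * x) + ρ * Real.exp (-a * x) ≤
      Real.exp ((-2 * μ - a) * x) + ρ * Real.exp (-a * t₀) := by
    have hprod : 0 ≤ (Real.exp (-2 * μ * x) - ρ) *
        (Real.exp (-a * x) - Real.exp (-a * t₀)) := by
      rw [← hρt]
      rcases le_total x t₀ with h | h
      · exact mul_nonneg (sub_nonneg.2 (Real.exp_le_exp.2 (by nlinarith)))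
          (sub_nonneg.2 (Real.exp_le_exp.2 (by nlinarith)))
      · exact mul_nonneg_of_nonpos_of_nonpos (sub_nonpos.2 (Real.exp_le_exp.2 (by nlinarith)))
          (sub_nonpos.2 (Real.exp_le_exp.2 (by nlinarith)))
    have : Real.exp ((-2 * μ - a) * x) = Real.exp (-2 * μ * x) * Real.exp (-a * x) := by
      rw [← Real.exp_add]; ring_nf
    rw [this]
    linarith
  have hle := integral_mono (((hint (-2 * μ)).const_mul _).add ((hint (-a)).const_mul _))
    ((hint (-2 * μ - a)).add (integrable_const _)) hpt
  simp only [Pi.add_apply] at hle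
  rw [integral_add ((hint (-2 * μ)).const_mul _) ((hint (-a)).const_mul _),
    integral_add (hint (-2 * μ - a)) (integrable_const _), integral_const_mul, integral_const_mul,
    hval, hval, hval, integral_const, hW, measureReal_restrict_apply_univ] at hle
  change _ ≤ _ + gaussianTail μ • _ at hle
  have e1 : -2 * μ * μ + (-2 * μ) ^ 2 / 2 = 0 := by ring
  have e2 : (-2 * μ - a) * μ + (-2 * μ - a) ^ 2 / 2 =
    2 * μ * a + (-a * μ + (-a) ^ 2 / 2) := by ring
  rw [e1, e2, Real.exp_zero, one_mul, Real.exp_add (2 * μ * a), smul_eq_mul,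
    show μ + -2 * μ = -μ by ring, show μ + (-2 * μ - a) = -μ - a by ring, ← sub_eq_add_neg] at hle
  have hρT : ρ * gaussianTail μ = gaussianTail (-μ) := div_mul_cancel₀ _ hT.ne'
  have hle' : ρ * gaussianTail (μ - a) ≤ Real.exp (2 * μ * a) * gaussianTail (-μ - a) := by
    refine le_of_mul_le_mul_left ?_ (Real.exp_pos (-a * μ + (-a) ^ 2 / 2))
    have : gaussianTail μ * (ρ * Real.exp (-a * t₀)) =
      gaussianTail (-μ) * Real.exp (-a * t₀) := by rw [← hρT]; ring
    linarith
  have := mul_le_mul_of_nonneg_right hle' hT.le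
  rw [← hρT]
  linarith

/-! ### One-step inequalities for the frozen exponential. -/

/-- The function equal to `A` above `b`, to `B` below `-b`, and to `e` on `[-b, b]`. -/
noncomputable def twoSided (e : ℝ → ℝ) (A B b : ℝ) (x : ℝ) : ℝ :=
  if b < x then A else if x < -b then B else e x

lemma integral_twoSided_sub {e : ℝ → ℝ} {b : ℝ} (hb : 0 < b) {ν : Measure ℝ} [IsFiniteMeasure ν]
    (he : Integrable e ν) (A B : ℝ) :
    ∫ x, twoSided e A B b x ∂ν = ∫ x, e x ∂ν + ∫ x in Set.Ioi b, (A - e x) ∂ν +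
      ∫ x in Set.Iio (-b), (B - e x) ∂ν := by
  have hA : Integrable (fun x ↦ A - e x) ν := (integrable_const A).sub he
  have hB : Integrable (fun x ↦ B - e x) ν := (integrable_const B).sub he
  rw [← integral_indicator measurableSet_Ioi, ← integral_indicator measurableSet_Iio,
    ← integral_add he (hA.indicator measurableSet_Ioi),
    ← integral_add (f := fun x ↦ e x + (Set.Ioi b).indicator (fun x ↦ A - e x) x)
      (he.add (hA.indicator measurableSet_Ioi)) (hB.indicator measurableSet_Iio)]
  refine integral_congr_ae (ae_of_all _ fun x ↦ ?_)
  rcases lt_or_ge b x with h | h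
  · have : ¬ x < -b := by linarith
    simp [twoSided, h, this]
  · rcases lt_or_ge x (-b) with h' | h'
    · simp [twoSided, h', not_lt.2 h]
    · simp [twoSided, not_lt.2 h', not_lt.2 h]

/-- Harmonicity: `-2 * μ` is the nonzero root of `c * μ + c ^ 2 / 2 = 0`. -/
lemma integral_exp_gaussianReal_drift (μ s : ℝ) :
    ∫ x, Real.exp (-2 * μ * x) ∂gaussianReal (s + μ) 1 = Real.exp (-2 * μ * s) := by
  have := setIntegral_exp_gaussianReal (-2 * μ) (s + μ) MeasurableSet.univ
  rw [setIntegral_univ, probReal_univ, mul_one] at this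
  rw [this]
  congr 1
  ring

lemma setIntegral_pos_gaussianReal {m : ℝ} {S : Set ℝ} (hS : MeasurableSet S) (hS' : volume S ≠ 0)
    {f : ℝ → ℝ} (hf : Integrable f (gaussianReal m 1)) (hpos : ∀ x ∈ S, 0 < f x) :
    0 < ∫ x in S, f x ∂gaussianReal m 1 := by
  rw [setIntegral_pos_iff_support_of_nonneg_ae
    ((ae_restrict_iff' hS).2 (ae_of_all _ fun x hx ↦ (hpos x hx).le)) hf.integrableOn]
  rw [Set.inter_eq_right.2 fun x hx ↦ Function.mem_support.2 (hpos x hx).ne']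
  exact (ENNReal.toReal_pos_iff.1 (gaussianReal_real_pos m hS')).1

lemma setIntegral_const_sub_exp_gaussianReal (B μ s : ℝ) {S : Set ℝ} (hS : MeasurableSet S) :
    ∫ x in S, (B - Real.exp (-2 * μ * x)) ∂gaussianReal (s + μ) 1 =
      B * (gaussianReal (s + μ) 1).real S -
        Real.exp (-2 * μ * s) * (gaussianReal (s - μ) 1).real S := by
  rw [integral_sub (integrable_const _) (integrable_exp_mul_gaussianReal _).restrict,
    setIntegral_exp_gaussianReal _ _ hS, integral_const, measureReal_restrict_apply_univ,
    smul_eq_mul, mul_comm B]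
  congr 3
  · ring
  · congr 1; ring

/-- By harmonicity only the corrections outside `[-b, b]` matter. The upper one is strictly positive
pointwise; the lower one is nonnegative only on average, by `gaussianTail_mul_le` at the distance `b
+ s` to the lower boundary. -/
lemma exp_lt_integral_twoSided {μ b s : ℝ} (hμ : 0 < μ) (hb : 0 < b) (hs : -b ≤ s) :
    Real.exp (-2 * μ * s) < ∫ x, twoSided (fun x ↦ Real.exp (-2 * μ * x)) (Real.exp (-2 * μ * b))
      (Real.exp (2 * μ * b) * normalOdds μ) b x ∂gaussianReal (s + μ) 1 := by
  have hi : Integrable (fun x ↦ Real.exp (-2 * μ * x)) (gaussianReal (s + μ) 1) :=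
    integrable_exp_mul_gaussianReal _
  rw [integral_twoSided_sub hb hi, integral_exp_gaussianReal_drift]
  have h1 : 0 < ∫ x in Set.Ioi b, (Real.exp (-2 * μ * b) - Real.exp (-2 * μ * x))
      ∂gaussianReal (s + μ) 1 :=
    setIntegral_pos_gaussianReal measurableSet_Ioi (by simp) ((integrable_const _).sub hi)
      fun x hx ↦ sub_pos.2 (Real.exp_lt_exp.2 (by nlinarith [Set.mem_Ioi.1 hx]))
  have h2 : 0 ≤ ∫ x in Set.Iio (-b), (Real.exp (2 * μ * b) * normalOdds μ -
      Real.exp (-2 * μ * x)) ∂gaussianReal (s + μ) 1 := by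
    rw [setIntegral_const_sub_exp_gaussianReal _ _ _ measurableSet_Iio, gaussianReal_real_Iio,
      gaussianReal_real_Iio, normalOdds_eq]
    have key := gaussianTail_mul_le (a := b + s) hμ (by linarith)
    rw [show μ - (b + s) = -b - (s - μ) by ring, show -μ - (b + s) = -b - (s + μ) by ring,
      show 2 * μ * (b + s) = 2 * μ * b - -2 * μ * s by ring, Real.exp_sub] at key
    have hT' := gaussianTail_pos (-μ)
    have he := Real.exp_pos (-2 * μ * s)
    rw [sub_nonneg]
    field_simp at key ⊢
    linarith
  linarith

/-- The mirror case: strictness comes from below `-b`, and the tail inequality is used at the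
distance `b - s` to the upper boundary. -/
lemma integral_twoSided_lt_exp {μ b s : ℝ} (hμ : 0 < μ) (hb : 0 < b) (hs : s ≤ b) :
    ∫ x, twoSided (fun x ↦ Real.exp (-2 * μ * x)) (normalOdds (-μ) * Real.exp (-2 * μ * b))
      (Real.exp (2 * μ * b)) b x ∂gaussianReal (s + μ) 1 < Real.exp (-2 * μ * s) := by
  have hi : Integrable (fun x ↦ Real.exp (-2 * μ * x)) (gaussianReal (s + μ) 1) :=
    integrable_exp_mul_gaussianReal _
  rw [integral_twoSided_sub hb hi, integral_exp_gaussianReal_drift]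
  have h1 : 0 < ∫ x in Set.Iio (-b), (Real.exp (-2 * μ * x) - Real.exp (2 * μ * b))
      ∂gaussianReal (s + μ) 1 :=
    setIntegral_pos_gaussianReal measurableSet_Iio (by simp) (hi.sub (integrable_const _))
      fun x hx ↦ sub_pos.2 (Real.exp_lt_exp.2 (by nlinarith [Set.mem_Iio.1 hx]))
  have h1' : ∫ x in Set.Iio (-b), (Real.exp (2 * μ * b) - Real.exp (-2 * μ * x))
      ∂gaussianReal (s + μ) 1 < 0 := by
    rw [← neg_pos, ← integral_neg]
    simpa using h1
  have h2 : ∫ x in Set.Ioi b, (normalOdds (-μ) * Real.exp (-2 * μ * b) -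
      Real.exp (-2 * μ * x)) ∂gaussianReal (s + μ) 1 ≤ 0 := by
    rw [setIntegral_const_sub_exp_gaussianReal _ _ _ measurableSet_Ioi, gaussianReal_real_Ioi,
      gaussianReal_real_Ioi, normalOdds_eq, neg_neg]
    have key := gaussianTail_mul_le (a := b - s) hμ (by linarith)
    rw [show μ - (b - s) = s + μ - b by ring, show -μ - (b - s) = s - μ - b by ring,
      show 2 * μ * (b - s) = -2 * μ * s - -2 * μ * b by ring, Real.exp_sub] at key
    have hT := gaussianTail_pos μ
    have he := Real.exp_pos (-2 * μ * b)
    rw [sub_nonpos]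
    field_simp at key ⊢
    linarith
  linarith

/-! ### Independence, and the exit events of the walk. -/

lemma integral_comp_prodMk_of_indepFun {Ω α β : Type*} [MeasurableSpace Ω] [MeasurableSpace α]
    [MeasurableSpace β] {P : Measure Ω} [IsProbabilityMeasure P] {V : Ω → α} {Y : Ω → β}
    (hV : Measurable V) (hY : Measurable Y) (hVY : IndepFun V Y P) {g : α × β → ℝ}
    (hg : Measurable g) {C : ℝ} (hC : ∀ x, |g x| ≤ C) :
    ∫ ω, g (V ω, Y ω) ∂P = ∫ ω, ∫ z, g (V ω, z) ∂(P.map Y) ∂P := by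
  have := Measure.isProbabilityMeasure_map (μ := P) hV.aemeasurable
  have := Measure.isProbabilityMeasure_map (μ := P) hY.aemeasurable
  have hint : Integrable g ((P.map V).prod (P.map Y)) :=
    Integrable.of_bound hg.aestronglyMeasurable C (ae_of_all _ hC)
  rw [← integral_map (f := g) (hV.prodMk hY).aemeasurable hg.aestronglyMeasurable,
    (indepFun_iff_map_prod_eq_prod_map_map hV.aemeasurable hY.aemeasurable).1 hVY,
    integral_prod _ hint]
  exact integral_map (f := fun v ↦ ∫ z, g (v, z) ∂(P.map Y)) hV.aemeasurable
    hg.stronglyMeasurable.integral_prod_right'.aestronglyMeasurable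

/-- The event that the walk has not left `[-b, b]` up to time `k`. -/
def stayEvent {Ω : Type*} (Z : ℕ → Ω → ℝ) (b : ℝ) (k : ℕ) : Set Ω :=
  {ω | ∀ j ≤ k, partialSum Z j ω ∈ Set.Icc (-b) b}

/-- The event that the walk leaves `[-b, b]` at time `k + 1`, upwards. -/
def exitUpEvent {Ω : Type*} (Z : ℕ → Ω → ℝ) (b : ℝ) (k : ℕ) : Set Ω :=
  stayEvent Z b k ∩ {ω | b < partialSum Z (k + 1) ω}

lemma partialSum_zero {Ω : Type*} (Z : ℕ → Ω → ℝ) (ω : Ω) : partialSum Z 0 ω = 0 := by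
  simp [partialSum]

lemma partialSum_succ {Ω : Type*} (Z : ℕ → Ω → ℝ) (k : ℕ) (ω : Ω) :
    partialSum Z (k + 1) ω = partialSum Z k ω + Z k ω := Finset.sum_range_succ _ _

lemma stayEvent_succ_subset {Ω : Type*} (Z : ℕ → Ω → ℝ) (b : ℝ) (k : ℕ) :
    stayEvent Z b (k + 1) ⊆ stayEvent Z b k := fun _ h j hj ↦ h j (hj.trans k.le_succ)

lemma mem_stayEvent_succ {Ω : Type*} {Z : ℕ → Ω → ℝ} {b : ℝ} {k : ℕ} {ω : Ω} :
    ω ∈ stayEvent Z b (k + 1) ↔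
      ω ∈ stayEvent Z b k ∧ partialSum Z (k + 1) ω ∈ Set.Icc (-b) b := by
  refine ⟨fun h ↦ ⟨stayEvent_succ_subset Z b k h, h _ le_rfl⟩, fun h j hj ↦ ?_⟩
  rcases Nat.le_succ_iff.1 hj with hj | rfl
  exacts [h.1 j hj, h.2]

lemma stayEvent_zero {Ω : Type*} (Z : ℕ → Ω → ℝ) {b : ℝ} (hb : 0 < b) :
    stayEvent Z b 0 = Set.univ := by
  ext ω
  simp [stayEvent, partialSum_zero, hb.le]

lemma exitUpEvent_disjoint {Ω : Type*} (Z : ℕ → Ω → ℝ) (b : ℝ) :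
    Pairwise (Function.onFun Disjoint (exitUpEvent Z b)) := by
  refine (pairwise_disjoint_on _).2 fun m n hmn ↦ Set.disjoint_left.2 fun ω hm hn ↦ ?_
  exact absurd (hn.1 (m + 1) hmn).2 (not_le.2 hm.2)

lemma exitTime_eq_top_iff {Ω : Type*} {Z : ℕ → Ω → ℝ} {b : ℝ} (hb : 0 < b) {ω : Ω} :
    exitTime Z b ω = ⊤ ↔ ∀ k, ω ∈ stayEvent Z b k := by
  rw [exitTime, hittingAfter_eq_top_iff]
  constructor
  · intro h k j _
    rcases Nat.eq_zero_or_pos j with rfl | hj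
    · simp [partialSum_zero, hb.le]
    · simpa [not_or] using h j hj
  · intro h j _
    simpa [not_or] using h j j le_rfl

lemma setOf_exitTime_up {Ω : Type*} (Z : ℕ → Ω → ℝ) {b : ℝ} (hb : 0 < b) :
    {ω | exitTime Z b ω ≠ ⊤ ∧ b < stoppedValue (partialSum Z) (exitTime Z b) ω} =
      ⋃ k, exitUpEvent Z b k := by
  ext ω
  simp only [Set.mem_ofPred_eq, Set.mem_iUnion, stoppedValue]
  constructor
  · rintro ⟨h, h'⟩
    obtain ⟨m, hm⟩ := WithTop.ne_top_iff_exists.1 h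
    rw [← hm] at h'
    change b < partialSum Z m ω at h'
    -- The search starts at time 1, so the exit time has the form `k + 1`.
    have hm1 : ((1 : ℕ) : WithTop ℕ) ≤ exitTime Z b ω := le_hittingAfter ω
    rw [← hm] at hm1
    obtain ⟨k, rfl⟩ := Nat.exists_eq_add_of_le' (WithTop.coe_le_coe.1 hm1)
    refine ⟨k, fun j hj ↦ ?_, h'⟩
    rcases Nat.eq_zero_or_pos j with rfl | hj0
    · simp [partialSum_zero, hb.le]
    · have := notMem_of_lt_hittingAfter (u := partialSum Z) (s := {x : ℝ | x < -b ∨ b < x})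
        (n := 1) (ω := ω) (k := j) (by
          change _ < exitTime Z b ω
          rw [← hm]
          exact_mod_cast Nat.lt_succ_of_le hj) hj0
      simpa [not_or] using this
  · rintro ⟨k, hk, hk'⟩
    have hle : exitTime Z b ω ≤ ((k + 1 : ℕ) : WithTop ℕ) :=
      hittingAfter_le_of_mem (Nat.le_add_left 1 k) (Or.inr hk')
    have htop : exitTime Z b ω ≠ ⊤ := ne_top_of_le_ne_top (WithTop.coe_ne_top) hle
    refine ⟨htop, ?_⟩
    obtain ⟨m, hm⟩ := WithTop.ne_top_iff_exists.1 htop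
    have hmem : partialSum Z (exitTime Z b ω).untopA ω ∈ {x : ℝ | x < -b ∨ b < x} :=
      hittingAfter_mem_set_of_ne_top htop
    rw [← hm] at hmem ⊢
    change partialSum Z m ω ∈ _ at hmem
    change b < partialSum Z m ω
    rw [← hm] at hle
    rcases Nat.lt_or_ge m (k + 1) with h | h
    · have := hk m (Nat.lt_succ_iff.1 h)
      rcases hmem with h1 | h1
      · exact absurd this.1 (not_le.2 h1)
      · exact h1
    · rwa [le_antisymm (WithTop.coe_le_coe.1 hle) h]

/-! ### Markov property and almost sure exit. -/

section Walk

variable {Ω : Type*} [MeasurableSpace Ω] {P : Measure Ω} [IsProbabilityMeasure P]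
  {Z : ℕ → Ω → ℝ} {μ b : ℝ}

lemma measurable_partialSum (hZ : ∀ i, Measurable (Z i)) (k : ℕ) : Measurable (partialSum Z k) :=
  Finset.measurable_sum _ fun i _ ↦ hZ i

lemma measurableSet_stayEvent (hZ : ∀ i, Measurable (Z i)) (b : ℝ) (k : ℕ) :
    MeasurableSet (stayEvent Z b k) := by
  have : stayEvent Z b k = ⋂ j, ⋂ _ : j ≤ k, partialSum Z j ⁻¹' Set.Icc (-b) b := by
    ext; simp [stayEvent]
  rw [this]
  exact MeasurableSet.iInter fun j ↦ MeasurableSet.iInter fun _ ↦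
    measurable_partialSum hZ j measurableSet_Icc

lemma measurableSet_exitUpEvent (hZ : ∀ i, Measurable (Z i)) (b : ℝ) (k : ℕ) :
    MeasurableSet (exitUpEvent Z b k) :=
  (measurableSet_stayEvent hZ b k).inter
    (measurableSet_lt measurable_const (measurable_partialSum hZ _))

/-- The Markov property of the walk on the event that it has not yet left `[-b, b]`. -/
lemma setIntegral_partialSum_succ (hZ : ∀ i, Measurable (Z i))
    (hlaw : ∀ i, HasLaw (Z i) (gaussianReal μ 1) P) (hindep : iIndepFun Z P) (b : ℝ) (k : ℕ)
    {f : ℝ → ℝ} (hf : Measurable f) {C : ℝ} (hC : ∀ x, |f x| ≤ C) :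
    ∫ ω in stayEvent Z b k, f (partialSum Z (k + 1) ω) ∂P =
      ∫ ω in stayEvent Z b k, ∫ z, f (partialSum Z k ω + z) ∂gaussianReal μ 1 ∂P := by
  set X : ℕ → (ℕ → ℝ) → ℝ := fun i w ↦ w i with hX
  have hXm (i : ℕ) : Measurable (X i) := measurable_pi_apply i
  set V : Ω → (Finset.range k → ℝ) := fun ω i ↦ Z i ω with hV
  -- Padding by zeros embeds the first `k` increments in sequence space. It leaves the partial sums
  -- up to time `k` unchanged, so the stay event is a function of `V`, which is independent of `Z
  -- k`.
  set E : (Finset.range k → ℝ) → ℕ → ℝ :=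
    fun v i ↦ if h : i ∈ Finset.range k then v ⟨i, h⟩ else 0 with hE
  have hVm : Measurable V := measurable_pi_lambda _ fun i ↦ hZ i
  have hEm : Measurable E := by
    refine measurable_pi_lambda _ fun i ↦ ?_
    by_cases h : i ∈ Finset.range k
    · simpa only [hE, h, dite_true] using measurable_pi_apply (⟨i, h⟩ : Finset.range k)
    · simpa only [hE, h, dite_false] using measurable_const
  have hS (ω : Ω) (j : ℕ) (hj : j ≤ k) : partialSum X j (E (V ω)) = partialSum Z j ω := by
    refine Finset.sum_congr rfl fun i hi ↦ ?_
    have : i ∈ Finset.range k := Finset.range_mono hj hi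
    simp only [hX, hE, hV, this, dite_true]
  have hstay (ω : Ω) : E (V ω) ∈ stayEvent X b k ↔ ω ∈ stayEvent Z b k :=
    forall₂_congr fun j hj ↦ by rw [hS ω j hj]
  have hind : IndepFun V (Z k) P := by
    have h := hindep.indepFun_finset (Finset.range k) {k} (by simp) hZ
    exact h.comp (φ := id) (ψ := fun v : ({k} : Finset ℕ) → ℝ ↦ v ⟨k, by simp⟩) measurable_id
      (measurable_pi_apply _)
  set g : (Finset.range k → ℝ) × ℝ → ℝ := fun p ↦ ((E ⁻¹' stayEvent X b k) ×ˢ Set.univ).indicator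
    (fun p : (Finset.range k → ℝ) × ℝ ↦ f (partialSum X k (E p.1) + p.2)) p with hg
  have hgm : Measurable g := Measurable.indicator
    (hf.comp ((((measurable_partialSum hXm k).comp hEm).comp measurable_fst).add measurable_snd))
    ((hEm (measurableSet_stayEvent hXm b k)).prod MeasurableSet.univ)
  have hgC (p) : |g p| ≤ C := by
    by_cases h : p ∈ (E ⁻¹' stayEvent X b k) ×ˢ (Set.univ : Set ℝ)
    · simp only [hg, Set.indicator_of_mem h, hC]
    · simpa only [hg, Set.indicator_of_notMem h, abs_zero] using (abs_nonneg _).trans (hC 0)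
  have hgval (ω : Ω) (z : ℝ) : g (V ω, z) =
      (stayEvent Z b k).indicator (fun ω ↦ f (partialSum Z k ω + z)) ω := by
    by_cases h : ω ∈ stayEvent Z b k
    · simp [hg, (hstay ω).2 h, h, hS ω k le_rfl]
    · simp [hg, mt (hstay ω).1 h, h]
  have key := integral_comp_prodMk_of_indepFun hVm (hZ k) hind hgm hgC
  rw [(hlaw k).map_eq] at key
  rw [← integral_indicator (measurableSet_stayEvent hZ b k),
    ← integral_indicator (measurableSet_stayEvent hZ b k)]
  convert key using 1
  · refine integral_congr_ae (ae_of_all _ fun ω ↦ ?_)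
    by_cases h : ω ∈ stayEvent Z b k <;> simp [hgval, h, partialSum_succ]
  · refine integral_congr_ae (ae_of_all _ fun ω ↦ ?_)
    simp only [hgval]
    by_cases h : ω ∈ stayEvent Z b k <;> simp [h]

lemma integral_comp_const_add_gaussianReal (f : ℝ → ℝ) (hf : Measurable f) (μ s : ℝ) :
    ∫ z, f (s + z) ∂gaussianReal μ 1 = ∫ x, f x ∂gaussianReal (s + μ) 1 := by
  rw [add_comm s μ, ← gaussianReal_map_const_add s,
    integral_map (by fun_prop) hf.aestronglyMeasurable]

/-- From the worst starting point `-b`, one increment above `2 * b` suffices to exit upwards. This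
uniform chance makes the survival probability decay geometrically. -/
lemma stayEvent_real_mul_le (hZ : ∀ i, Measurable (Z i))
    (hlaw : ∀ i, HasLaw (Z i) (gaussianReal μ 1) P) (hindep : iIndepFun Z P) (k : ℕ) :
    P.real (stayEvent Z b k) * gaussianTail (μ - 2 * b) ≤ P.real (exitUpEvent Z b k) := by
  have hG := measurableSet_stayEvent hZ b k
  have hf : Measurable ((Set.Ioi b).indicator (1 : ℝ → ℝ)) :=
    measurable_one.indicator measurableSet_Ioi
  have h := setIntegral_partialSum_succ hZ hlaw hindep b k hf (C := 1) (fun x ↦ by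
    simp only [Set.indicator_apply]; split_ifs <;> simp)
  have hl : ∫ ω in stayEvent Z b k, (Set.Ioi b).indicator (1 : ℝ → ℝ) (partialSum Z (k + 1) ω) ∂P =
      P.real (exitUpEvent Z b k) := by
    rw [← integral_indicator hG, ← integral_indicator_one (measurableSet_exitUpEvent hZ b k)]
    refine integral_congr_ae (ae_of_all _ fun ω ↦ ?_)
    by_cases h1 : ω ∈ stayEvent Z b k <;> by_cases h2 : b < partialSum Z (k + 1) ω <;>
      simp [exitUpEvent, h1, h2]
  simp_rw [integral_comp_const_add_gaussianReal _ hf, integral_indicator_one measurableSet_Ioi,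
    gaussianReal_real_Ioi] at h
  rw [← hl, h, ← smul_eq_mul, ← setIntegral_const]
  refine setIntegral_mono_on (integrable_const _).integrableOn ?_ hG fun ω hω ↦
    gaussianTail_mono (by linarith [(hω k le_rfl).1])
  refine (Integrable.of_bound (gaussianTail_mono.measurable.comp
    (((measurable_partialSum hZ k).add_const μ).sub_const b)).aestronglyMeasurable 1
    (ae_of_all _ fun ω ↦ ?_)).integrableOn
  rw [Function.comp_apply, Real.norm_of_nonneg (gaussianTail_pos _).le]
  exact gaussianTail_le_one _

lemma tendsto_stayEvent_real (hZ : ∀ i, Measurable (Z i))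
    (hlaw : ∀ i, HasLaw (Z i) (gaussianReal μ 1) P) (hindep : iIndepFun Z P) :
    Filter.Tendsto (fun n ↦ P.real (stayEvent Z b n)) Filter.atTop (nhds 0) := by
  have hc := gaussianTail_pos (μ - 2 * b)
  have hc1 := gaussianTail_le_one (μ - 2 * b)
  have hstep (n : ℕ) : P.real (stayEvent Z b (n + 1)) ≤
      (1 - gaussianTail (μ - 2 * b)) * P.real (stayEvent Z b n) := by
    have hsub : stayEvent Z b (n + 1) ⊆ stayEvent Z b n \ exitUpEvent Z b n := fun ω hω ↦
      ⟨stayEvent_succ_subset Z b n hω, fun h ↦ absurd (hω _ le_rfl).2 (not_le.2 h.2)⟩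
    have h1 := measureReal_mono (μ := P) hsub
    rw [measureReal_sdiff (s₁ := stayEvent Z b n) (fun _ h ↦ h.1)
      (measurableSet_exitUpEvent hZ b n)] at h1
    linarith [stayEvent_real_mul_le (b := b) hZ hlaw hindep n]
  have hle (n : ℕ) : P.real (stayEvent Z b n) ≤ (1 - gaussianTail (μ - 2 * b)) ^ n := by
    induction n with
    | zero => simp
    | succ n ih =>
      rw [pow_succ']
      exact (hstep n).trans (mul_le_mul_of_nonneg_left ih (by linarith))
  exact squeeze_zero (fun _ ↦ measureReal_nonneg) hle
    (tendsto_pow_atTop_nhds_zero_of_lt_one (by linarith) (by linarith))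

lemma ae_exitTime_ne_top (hb : 0 < b) (hZ : ∀ i, Measurable (Z i))
    (hlaw : ∀ i, HasLaw (Z i) (gaussianReal μ 1) P) (hindep : iIndepFun Z P) :
    ∀ᵐ ω ∂P, exitTime Z b ω ≠ ⊤ := by
  have hle (n : ℕ) : P.real {ω | ¬ exitTime Z b ω ≠ ⊤} ≤ P.real (stayEvent Z b n) :=
    measureReal_mono fun ω hω ↦ (exitTime_eq_top_iff hb).1 (not_not.1 hω) n
  have h0 := ge_of_tendsto' (tendsto_stayEvent_real (b := b) hZ hlaw hindep) hle
  rw [ae_iff]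
  exact (measureReal_eq_zero_iff).1 (le_antisymm h0 measureReal_nonneg)

/-! ### Optional stopping with frozen boundary values. -/

lemma measurable_twoSided {e : ℝ → ℝ} (he : Measurable e) (A B b : ℝ) :
    Measurable (twoSided e A B b) :=
  Measurable.ite measurableSet_Ioi measurable_const
    (Measurable.ite measurableSet_Iio measurable_const he)

lemma abs_twoSided_le {e : ℝ → ℝ} {C : ℝ} (hC : ∀ x ∈ Set.Icc (-b) b, |e x| ≤ C) (A B x : ℝ) :
    |twoSided e A B b x| ≤ max C (max |A| |B|) := by
  unfold twoSided
  split_ifs with h h'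
  · simp
  · simp
  · exact (hC x ⟨not_lt.1 h', not_lt.1 h⟩).trans (le_max_left _ _)

lemma twoSided_of_mem {e : ℝ → ℝ} {A B x : ℝ} (hx : x ∈ Set.Icc (-b) b) :
    twoSided e A B b x = e x := by
  rw [twoSided, if_neg (not_lt.2 hx.2), if_neg (not_lt.2 hx.1)]

/-- Optional stopping: if freezing `e` at the boundary values `A`, `B` makes every step of the walk
from `[-b, b]` increase its expectation, then `e 0` lies below the expected boundary value. -/
lemma lt_of_lt_integral_twoSided (hb : 0 < b) (hZ : ∀ i, Measurable (Z i))
    (hlaw : ∀ i, HasLaw (Z i) (gaussianReal μ 1) P) (hindep : iIndepFun Z P)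
    {e : ℝ → ℝ} (he : Measurable e) {C : ℝ} (hC : ∀ x ∈ Set.Icc (-b) b, |e x| ≤ C) {A B : ℝ}
    (hstep : ∀ s ∈ Set.Icc (-b) b, e s < ∫ x, twoSided e A B b x ∂gaussianReal (s + μ) 1) :
    e 0 < A * P.real (⋃ k, exitUpEvent Z b k) +
      B * (1 - P.real (⋃ k, exitUpEvent Z b k)) := by
  set f := twoSided e A B b with hf
  set C' := max C (max |A| |B|) with hC'
  have hfm : Measurable f := measurable_twoSided he A B b
  have hfC (x : ℝ) : |f x| ≤ C' := abs_twoSided_le hC A B x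
  have hG := measurableSet_stayEvent hZ b
  have hU := measurableSet_exitUpEvent hZ b
  have hfi (m : ℕ) : Integrable (fun ω ↦ f (partialSum Z m ω)) P :=
    Integrable.of_bound (hfm.comp (measurable_partialSum hZ m)).aestronglyMeasurable C'
      (ae_of_all _ fun ω ↦ hfC _)
  set I : ℕ → ℝ := fun n ↦ ∫ ω in stayEvent Z b n, f (partialSum Z n ω) ∂P with hI
  -- `J n` is the mean of the frozen function at the walk stopped on exit or at time `n`; the factor
  -- of `B` is the probability of a downward exit by then.
  set J : ℕ → ℝ := fun n ↦ A * ∑ k ∈ Finset.range n, P.real (exitUpEvent Z b k) +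
    B * (1 - ∑ k ∈ Finset.range n, P.real (exitUpEvent Z b k) - P.real (stayEvent Z b n)) + I n
    with hJ
  have hdiff (n : ℕ) : J (n + 1) - J n =
      ∫ ω in stayEvent Z b n, f (partialSum Z (n + 1) ω) ∂P - I n := by
    have hsplit : ∫ ω in stayEvent Z b n, f (partialSum Z (n + 1) ω) ∂P =
        A * P.real (exitUpEvent Z b n) + B * (P.real (stayEvent Z b n) -
          P.real (exitUpEvent Z b n) - P.real (stayEvent Z b (n + 1))) + I (n + 1) := by
      have i1 (S : Set Ω) (hS : MeasurableSet S) :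
          Integrable (fun ω ↦ S.indicator (1 : Ω → ℝ) ω) P :=
        (integrable_const (1 : ℝ)).indicator hS
      have i2 : Integrable (fun ω ↦ (stayEvent Z b n).indicator (1 : Ω → ℝ) ω -
          (exitUpEvent Z b n).indicator (1 : Ω → ℝ) ω) P := (i1 _ (hG n)).sub (i1 _ (hU n))
      have i3 : Integrable (fun ω ↦ A * (exitUpEvent Z b n).indicator (1 : Ω → ℝ) ω) P :=
        (i1 _ (hU n)).const_mul A
      have i4 : Integrable (fun ω ↦ B * ((stayEvent Z b n).indicator (1 : Ω → ℝ) ω -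
          (exitUpEvent Z b n).indicator (1 : Ω → ℝ) ω -
          (stayEvent Z b (n + 1)).indicator (1 : Ω → ℝ) ω)) P :=
        (i2.sub (i1 _ (hG (n + 1)))).const_mul B
      have i5 : Integrable (fun ω ↦ A * (exitUpEvent Z b n).indicator (1 : Ω → ℝ) ω +
          B * ((stayEvent Z b n).indicator (1 : Ω → ℝ) ω -
          (exitUpEvent Z b n).indicator (1 : Ω → ℝ) ω -
          (stayEvent Z b (n + 1)).indicator (1 : Ω → ℝ) ω)) P := i3.add i4
      simp only [hI]
      rw [← integral_indicator (hG n), ← integral_indicator (hG (n + 1)),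
        ← integral_indicator_one (hU n), ← integral_indicator_one (hG n),
        ← integral_indicator_one (hG (n + 1)), ← integral_const_mul,
        ← integral_sub (i1 _ (hG n)) (i1 _ (hU n)), ← integral_sub i2 (i1 _ (hG (n + 1))),
        ← integral_const_mul, ← integral_add i3 i4,
        ← integral_add i5 ((hfi (n + 1)).indicator (hG (n + 1)))]
      refine integral_congr_ae (ae_of_all _ fun ω ↦ ?_)
      by_cases h : ω ∈ stayEvent Z b n
      · rcases lt_or_ge b (partialSum Z (n + 1) ω) with h1 | h1
        · simp [mem_stayEvent_succ, exitUpEvent, h, h1, hf, twoSided, not_le.2 h1]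
        · rcases lt_or_ge (partialSum Z (n + 1) ω) (-b) with h2 | h2
          · simp [mem_stayEvent_succ, exitUpEvent, h, h2, hf, twoSided, not_lt.2 h1, not_le.2 h2]
          · simp [mem_stayEvent_succ, exitUpEvent, h, h2, h1, not_lt.2 h1]
      · simp [mem_stayEvent_succ, exitUpEvent, h]
    rw [hsplit]
    simp only [hJ, Finset.sum_range_succ]
    ring
  have hmono : Monotone J := by
    refine monotone_nat_of_le_succ fun n ↦ sub_nonneg.1 ?_
    rw [hdiff, setIntegral_partialSum_succ hZ hlaw hindep b n hfm hfC, sub_nonneg]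
    have hFm : StronglyMeasurable fun s : ℝ ↦ ∫ z, f (s + z) ∂gaussianReal μ 1 :=
      StronglyMeasurable.integral_prod_right'
        (f := fun p : ℝ × ℝ ↦ f (p.1 + p.2)) (hfm.comp measurable_add).stronglyMeasurable
    refine setIntegral_mono_on (hfi n).integrableOn ?_ (hG n) fun ω hω ↦ ?_
    · refine (Integrable.of_bound
        (hFm.comp_measurable (measurable_partialSum hZ n)).aestronglyMeasurable C'
        (ae_of_all _ fun ω ↦ ?_)).integrableOn
      refine (norm_integral_le_of_norm_le_const (ae_of_all _ fun z ↦ hfC _)).trans ?_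
      simp
    · rw [integral_comp_const_add_gaussianReal f hfm, hf, twoSided_of_mem (hω n le_rfl)]
      exact (hstep _ (hω n le_rfl)).le
  have h0 : (0 : ℝ) ∈ Set.Icc (-b) b := ⟨by linarith, hb.le⟩
  have hI0 : I 0 = e 0 := by
    simp [hI, stayEvent_zero Z hb, partialSum_zero, hf, twoSided_of_mem h0]
  have hJ0 : J 0 = e 0 := by
    simp [hJ, stayEvent_zero Z hb, hI0]
  -- The limit of a monotone sequence preserves only `≤`, so strictness is secured at the first
  -- step.
  have hJ1 : e 0 < J 1 := by
    have h := hdiff 0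
    rw [setIntegral_partialSum_succ hZ hlaw hindep b 0 hfm hfC, hJ0, hI0] at h
    rw [stayEvent_zero Z hb, setIntegral_univ] at h
    simp only [partialSum_zero, integral_const, probReal_univ, one_smul] at h
    rw [integral_comp_const_add_gaussianReal f hfm] at h
    have := hstep 0 h0
    linarith
  have hsum : Filter.Tendsto (fun n ↦ ∑ k ∈ Finset.range n, P.real (exitUpEvent Z b k))
      Filter.atTop (nhds (P.real (⋃ k, exitUpEvent Z b k))) := by
    have h := (ENNReal.summable (f := fun k ↦ P (exitUpEvent Z b k))).hasSum.tendsto_sum_nat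
    rw [← measure_iUnion (exitUpEvent_disjoint Z b) hU] at h
    have h' := (ENNReal.tendsto_toReal (measure_ne_top P _)).comp h
    refine h'.congr fun n ↦ ?_
    rw [Function.comp_apply, ENNReal.toReal_sum fun _ _ ↦ measure_ne_top _ _]
    rfl
  have hg := tendsto_stayEvent_real (b := b) hZ hlaw hindep
  have hIlim : Filter.Tendsto I Filter.atTop (nhds 0) := by
    refine squeeze_zero_norm (a := fun n ↦ C' * P.real (stayEvent Z b n)) (fun n ↦ ?_) ?_
    · exact norm_setIntegral_le_of_norm_le_const (measure_lt_top _ _) fun ω _ ↦ hfC _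
    · simpa using hg.const_mul C'
  have hJlim : Filter.Tendsto J Filter.atTop (nhds (A * P.real (⋃ k, exitUpEvent Z b k) +
      B * (1 - P.real (⋃ k, exitUpEvent Z b k) - 0) + 0)) :=
    ((hsum.const_mul A).add (((hsum.const_sub 1).sub hg).const_mul B)).add hIlim
  have := hmono.ge_of_tendsto hJlim 1
  rw [sub_zero, add_zero] at this
  exact hJ1.trans_le this

end Walk

/-! ### Assembling the two bounds. -/

theorem mainTheorem3 {Ω : Type*} [MeasurableSpace Ω] (P : Measure Ω) [IsProbabilityMeasure P]
    (Z : ℕ → Ω → ℝ) (μ b : ℝ) (hμ : 0 < μ) (hb : 0 < b)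
    (hlaw : ∀ i, HasLaw (Z i) (gaussianReal μ 1) P)
    (hindep : iIndepFun Z P) :
    (∀ᵐ ω ∂P, exitTime Z b ω ≠ ⊤) ∧
    (Real.exp (2 * μ * b) - 1) /
        (Real.exp (2 * μ * b) - normalOdds (-μ) * Real.exp (-2 * μ * b))
      < P.real {ω | exitTime Z b ω ≠ ⊤ ∧ b < stoppedValue (partialSum Z) (exitTime Z b) ω} ∧
    P.real {ω | exitTime Z b ω ≠ ⊤ ∧ b < stoppedValue (partialSum Z) (exitTime Z b) ω}
      < (Real.exp (2 * μ * b) * normalOdds μ - 1) /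
        (Real.exp (2 * μ * b) * normalOdds μ - Real.exp (-2 * μ * b)) := by
  -- `HasLaw` gives only a.e. measurability; measurable modifications change the whole path, hence
  -- the exit, on a null set only.
  wlog hZ : ∀ i, Measurable (Z i) generalizing Z
  · set Y : ℕ → Ω → ℝ := fun i ↦ (hlaw i).aemeasurable.mk (Z i) with hY
    have hYZ (i : ℕ) : Z i =ᵐ[P] Y i := (hlaw i).aemeasurable.ae_eq_mk
    have h := this Y (fun i ↦ (hlaw i).congr (hYZ i).symm) (hindep.congr hYZ)
      fun i ↦ (hlaw i).aemeasurable.measurable_mk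
    have hall : ∀ᵐ ω ∂P, ∀ m, partialSum Z m ω = partialSum Y m ω := by
      filter_upwards [ae_all_iff.2 hYZ] with ω hω m
      exact Finset.sum_congr rfl fun i _ ↦ hω i
    have hexit : ∀ᵐ ω ∂P, exitTime Z b ω = exitTime Y b ω := by
      filter_upwards [hall] with ω hω
      classical
      simp only [exitTime, hittingAfter_def, hω]
    have hset : P.real {ω | exitTime Z b ω ≠ ⊤ ∧
          b < stoppedValue (partialSum Z) (exitTime Z b) ω} =
        P.real {ω | exitTime Y b ω ≠ ⊤ ∧ b < stoppedValue (partialSum Y) (exitTime Y b) ω} := by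
      refine measureReal_congr ?_
      filter_upwards [hall, hexit] with ω hω hω'
      refine propext ?_
      change _ ∧ _ ↔ _ ∧ _
      simp only [stoppedValue, hω', hω]
    rw [hset]
    refine ⟨?_, h.2⟩
    filter_upwards [h.1, hexit] with ω h1 h2
    rwa [h2]
  refine ⟨ae_exitTime_ne_top hb hZ hlaw hindep, ?_⟩
  rw [setOf_exitTime_up Z hb]
  have hem : Measurable fun x : ℝ ↦ Real.exp (-2 * μ * x) := by fun_prop
  have hC : ∀ x ∈ Set.Icc (-b) b, |Real.exp (-2 * μ * x)| ≤ Real.exp (2 * μ * b) := fun x hx ↦ by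
    rw [Real.abs_exp]
    exact Real.exp_le_exp.2 (by nlinarith [hx.1])
  have hup := lt_of_lt_integral_twoSided hb hZ hlaw hindep hem hC
    fun s hs ↦ exp_lt_integral_twoSided hμ hb hs.1
  -- The supersolution becomes a subsolution after a change of sign.
  have hlow := lt_of_lt_integral_twoSided hb hZ hlaw hindep hem.neg
    (fun x hx ↦ (abs_neg _).trans_le (hC x hx))
    (A := -(normalOdds (-μ) * Real.exp (-2 * μ * b))) (B := -Real.exp (2 * μ * b)) fun s hs ↦ by
      have h := neg_lt_neg (integral_twoSided_lt_exp hμ hb hs.2)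
      rw [← integral_neg] at h
      refine h.trans_eq (integral_congr_ae (ae_of_all _ fun x ↦ ?_))
      simp only [twoSided, Pi.neg_apply]
      split_ifs <;> rfl
  rw [Pi.neg_apply] at hlow
  simp only [mul_zero, Real.exp_zero] at hup hlow
  have hT := gaussianTail_pos μ
  have hT' := gaussianTail_pos (-μ)
  have hmono : gaussianTail (-μ) ≤ gaussianTail μ := gaussianTail_mono (by linarith)
  -- `R(-μ) ≤ 1 ≤ R(μ)` makes both denominators positive.
  have hR : 1 ≤ normalOdds μ := by rwa [normalOdds_eq, one_le_div hT']
  have hR' : normalOdds (-μ) ≤ 1 := by rwa [normalOdds_eq, neg_neg, div_le_one hT]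
  have h1 : 1 < Real.exp (2 * μ * b) := Real.one_lt_exp_iff.2 (by positivity)
  have h2 : Real.exp (-2 * μ * b) < 1 := Real.exp_lt_one_iff.2 (by nlinarith [mul_pos hμ hb])
  have h3 := Real.exp_pos (-2 * μ * b)
  constructor
  · rw [div_lt_iff₀ (by nlinarith)]
    linarith
  · rw [lt_div_iff₀ (by nlinarith)]
    linarith
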